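/- \textbf{Setting.} Fix $p\in\mathbb N$ and $\beta^*\in\mathbb R^p$; let $S=\{j:\beta^*_j\neq 0\}$ and $S^c=\{j:\beta^*_j=0\}$. For each sample size $n$ let $X=X_n\in\mathbb R^{n\times p}$ be a deterministic design matrix with rows $x_1,\dots,x_n$, and let $y=X\beta^*+\varepsilon$, where the entries $\varepsilon_1,\dots,\varepsilon_n$ of the noise are i.i.d. $\mathcal N(0,\sigma^2)$. Assume that, as $n\to\infty$, $\frac1n X^\top X\to C$ with $C$ positive definite and $\frac1n\max_i\|x_i\|_2^2\to 0$. Let $m=m_n$ be positive integers with $n/m\to r_0\ge 0$, and let $\tilde\beta$ (depending on $n$) be a random initial estimator, independent of $\varepsilon$, such that $\sqrt m(\tilde\beta-\beta^*)$ converges in distribution to a random vector $z$ (in particular $\tilde\beta$ is $\sqrt m$-consistent). For $\lambda_n,\eta_n\ge 0$ let the Transfer Lasso estimator $\hat\beta_n$ be a (measurable) minimizer over $\beta\in\mathbb R^p$ of $$\frac1n\|y-X\beta\|_2^2+\frac{\lambda_n}{n}\sum_{j=1}^p|\beta_j|+\frac{\eta_n}{n}\sum_{j=1}^p|\beta_j-\tilde\beta_j|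 .$$ Let $W\sim\mathcal N(0,\sigma^2C)$ be independent of $z$. \textbf{Theorem (Asymptotic distribution for the Transfer Lasso).} As $n\to\infty$: (i) If $\eta_n/\sqrt n\to\infty$ and $\lambda_n/\eta_n\to\rho_0$ with $0\le\rho_0<1$, then $\sqrt m(\hat\beta_n-\beta^*)\overset{d}{\to}z$. (ii) If $\lambda_n/\sqrt n\to\lambda_0\ge0$ and $\eta_n/\sqrt n\to\eta_0\ge0$, then $$\sqrt n(\hat\beta_n-\beta^*)\overset{d}{\to}\operatorname*{argmin}_{u\in\mathbb R^p}\Big\{u^\top Cu-2u^\top W+\lambda_0\Big(\sum_{j\in S}u_j\,\mathrm{sgn}(\beta^*_j)+\sum_{j\in S^c}|u_j|\Big)+\eta_0\sum_{j=1}^p|u_j-\sqrt{r_0}\,z_j|\Big\}.$$ (iii) If $\lambda_n/\sqrt n\to\infty$, $\lambda_n/n\to0$ and $\eta_n/\lambda_n\to\rho_0'\ge0$, then $$\frac{n}{\lambda_n}(\hat\beta_n-\beta^*)\overset{d}{\to}\operatorname*{argmin}_{u\in\mathbb R^p}\Big\{u^\top Cu+\sum_{j\in S}\big(u_j\,\mathrm{sgn}(\beta^*_j)+\rho_0'|u_j|\big)+\sum_{j\in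 S^c}(1+\rho_0')|u_j|\Big\}.$$ In (ii) (for every realization of $W$ and $z$) and in (iii) the minimizer exists and is unique. -/

import Mathlib

open MeasureTheory ProbabilityTheory Filter Topology

/-- The set of global minimizers of a real-valued function. -/
def argminSet {α : Type*} (f : α → ℝ) : Set α :=
  {x | ∀ y, f x ≤ f y}

/-- The response vector `y = X β + ε` of the linear model. -/
noncomputable def linearResponse {n p : ℕ} (X : Matrix (Fin n) (Fin p) ℝ)
    (β : EuclideanSpace ℝ (Fin p)) (ε : Fin n → ℝ) : Fin n → ℝ :=
  fun i => (∑ j, X i j * β j) + ε i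

/-- The Transfer Lasso objective
`(1/n) ‖y - X β‖₂² + (lam/n) ∑ⱼ |βⱼ| + (eta/n) ∑ⱼ |βⱼ - βinitⱼ|` as a function of `β`. -/
noncomputable def transferLassoObjective {n p : ℕ} (X : Matrix (Fin n) (Fin p) ℝ)
    (y : Fin n → ℝ) (lam eta : ℝ) (βinit β : EuclideanSpace ℝ (Fin p)) : ℝ :=
  (1 / (n : ℝ)) * ∑ i, (y i - ∑ j, X i j * β j) ^ 2
    + (lam / n) * ∑ j, |β j| + (eta / n) * ∑ j, |β j - βinit j|

/-- The active set `S = {j : βⱼ ≠ 0}`. -/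
noncomputable def activeSet {p : ℕ} (β : EuclideanSpace ℝ (Fin p)) : Finset (Fin p) :=
  Finset.univ.filter fun j => β j ≠ 0

/-- The quadratic form `uᵀ C u`. -/
noncomputable def quadForm {p : ℕ} (C : Matrix (Fin p) (Fin p) ℝ)
    (u : EuclideanSpace ℝ (Fin p)) : ℝ :=
  ∑ i, ∑ j, u i * C i j * u j

/-- The limit criterion when both regularization parameters are of order `√n`; here `w` and `z`
are values of the Gaussian limit and of the limit of the rescaled initial estimator. -/
noncomputable def limitCriterionRootN {p : ℕ} (C : Matrix (Fin p) (Fin p) ℝ)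
    (βstar : EuclideanSpace ℝ (Fin p)) (lam0 eta0 r0 : ℝ)
    (w z u : EuclideanSpace ℝ (Fin p)) : ℝ :=
  quadForm C u - 2 * ∑ j, u j * w j
    + lam0 * ((∑ j ∈ activeSet βstar, u j * Real.sign (βstar j))
        + ∑ j ∈ (activeSet βstar)ᶜ, |u j|)
    + eta0 * ∑ j, |u j - Real.sqrt r0 * z j|

/-- The deterministic limit criterion when `√n ≪ lam ≪ n` and `eta / lam → rho`. -/
noncomputable def limitCriterionSlow {p : ℕ} (C : Matrix (Fin p) (Fin p) ℝ)
    (βstar : EuclideanSpace ℝ (Fin p)) (rho : ℝ) (u : EuclideanSpace ℝ (Fin p)) : ℝ :=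
  quadForm C u
    + (∑ j ∈ activeSet βstar, (u j * Real.sign (βstar j) + rho * |u j|))
    + ∑ j ∈ (activeSet βstar)ᶜ, (1 + rho) * |u j|

/-- A quadratic loss with linear term `w`, a penalty `P` of weight `κ` and an `ℓ¹` penalty towards
`t` of weight `θ`. -/
noncomputable def penalizedQuadratic {p : ℕ} (G : Matrix (Fin p) (Fin p) ℝ)
    (P : EuclideanSpace ℝ (Fin p) → ℝ) (κ θ : ℝ) (w t u : EuclideanSpace ℝ (Fin p)) : ℝ :=
  quadForm G u - 2 * ∑ j, u j * w j + κ * P u + θ * ∑ j, |u j - t j|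

/-- The directional derivative of the `ℓ¹` norm at `β`. -/
noncomputable def limitPenalty {p : ℕ} (β u : EuclideanSpace ℝ (Fin p)) : ℝ :=
  (∑ j ∈ activeSet β, u j * Real.sign (β j)) + ∑ j ∈ (activeSet β)ᶜ, |u j|

/-- The difference quotient of the `ℓ¹` norm at `β` with step `a`. -/
noncomputable def scaledPenalty {p : ℕ} (β : EuclideanSpace ℝ (Fin p)) (a : ℝ)
    (u : EuclideanSpace ℝ (Fin p)) : ℝ :=
  ∑ j, (|β j + a * u j| - |β j|) / a

section Deterministic

variable {p : ℕ}

local notation "E" => EuclideanSpace ℝ (Fin p)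

lemma limitCriterionRootN_eq (C : Matrix (Fin p) (Fin p) ℝ) (β : E) (κ θ r : ℝ) (w z : E) :
    limitCriterionRootN C β κ θ r w z
      = penalizedQuadratic C (limitPenalty β) κ θ w (Real.sqrt r • z) := by
  ext u
  simp [limitCriterionRootN, penalizedQuadratic, limitPenalty]

lemma limitCriterionSlow_eq (C : Matrix (Fin p) (Fin p) ℝ) (β : E) (ρ : ℝ) :
    limitCriterionSlow C β ρ = penalizedQuadratic C (limitPenalty β) 1 ρ 0 0 := by
  ext u
  have h : ∑ j, |u j| = (∑ j ∈ activeSet β, |u j|) + ∑ j ∈ (activeSet β)ᶜ, |u j| :=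
    (Finset.sum_add_sum_compl _ _).symm
  simp only [limitCriterionSlow, penalizedQuadratic, limitPenalty, Finset.sum_add_distrib,
    ← Finset.mul_sum, PiLp.zero_apply, mul_zero, Finset.sum_const_zero, sub_zero, one_mul, h]
  ring

lemma abs_coord_le_norm (u : E) (j : Fin p) : |u j| ≤ ‖u‖ := PiLp.norm_apply_le u j

lemma sum_abs_le_mul_norm (u : E) : ∑ j, |u j| ≤ p * ‖u‖ := by
  calc ∑ j, |u j| ≤ ∑ _j : Fin p, ‖u‖ := Finset.sum_le_sum fun j _ => abs_coord_le_norm u j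
    _ = p * ‖u‖ := by simp

lemma norm_le_sum_abs (u : E) : ‖u‖ ≤ ∑ j, |u j| := by
  rw [EuclideanSpace.norm_eq]
  refine Real.sqrt_le_iff.2 ⟨Finset.sum_nonneg fun _ _ => abs_nonneg _, ?_⟩
  exact Finset.sum_sq_le_sq_sum_of_nonneg fun _ _ => abs_nonneg _

lemma abs_sum_mul_le (u w : E) : |∑ j, u j * w j| ≤ ‖u‖ * ‖w‖ := by
  have h := abs_real_inner_le_norm w u
  rw [mul_comm ‖u‖]
  simpa [PiLp.inner_apply] using h

/-- The bilinear form of a matrix. -/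
noncomputable def matrixBilin (G : Matrix (Fin p) (Fin p) ℝ) (u v : E) : ℝ :=
  ∑ i, ∑ j, u i * G i j * v j

lemma quadForm_add_smul (G : Matrix (Fin p) (Fin p) ℝ) (v d : E) (s : ℝ) :
    quadForm G (v + s • d)
      = quadForm G v + s * (matrixBilin G v d + matrixBilin G d v) + s ^ 2 * quadForm G d := by
  simp only [quadForm, matrixBilin, Finset.mul_sum, ← Finset.sum_add_distrib, PiLp.add_apply,
    PiLp.smul_apply, smul_eq_mul]
  refine Finset.sum_congr rfl fun i _ => Finset.sum_congr rfl fun j _ => ?_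
  ring

lemma abs_matrixBilin_le (G : Matrix (Fin p) (Fin p) ℝ) (u v : E) :
    |matrixBilin G u v| ≤ (∑ i, ∑ j, |G i j|) * (‖u‖ * ‖v‖) := by
  rw [Finset.sum_mul]
  refine (Finset.abs_sum_le_sum_abs _ _).trans (Finset.sum_le_sum fun i _ => ?_)
  rw [Finset.sum_mul]
  refine (Finset.abs_sum_le_sum_abs _ _).trans (Finset.sum_le_sum fun j _ => ?_)
  rw [abs_mul, abs_mul]
  calc |u i| * |G i j| * |v j| = |G i j| * (|u i| * |v j|) := by ring
    _ ≤ _ := by gcongr <;> exact abs_coord_le_norm _ _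

lemma abs_quadForm_le (G : Matrix (Fin p) (Fin p) ℝ) (u : E) :
    |quadForm G u| ≤ (∑ i, ∑ j, |G i j|) * ‖u‖ ^ 2 := by
  rw [sq]; exact abs_matrixBilin_le G u u

lemma quadForm_sub (G H : Matrix (Fin p) (Fin p) ℝ) (u : E) :
    quadForm (G - H) u = quadForm G u - quadForm H u := by
  simp only [quadForm, ← Finset.sum_sub_distrib, Matrix.sub_apply]
  refine Finset.sum_congr rfl fun i _ => Finset.sum_congr rfl fun j _ => ?_
  ring

lemma quadForm_smul (G : Matrix (Fin p) (Fin p) ℝ) (s : ℝ) (u : E) :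
    quadForm G (s • u) = s ^ 2 * quadForm G u := by
  simp only [quadForm, Finset.mul_sum, PiLp.smul_apply, smul_eq_mul]
  refine Finset.sum_congr rfl fun i _ => Finset.sum_congr rfl fun j _ => ?_
  ring

lemma quadForm_zero (G : Matrix (Fin p) (Fin p) ℝ) : quadForm G (0 : E) = 0 := by
  simp [quadForm]

lemma continuous_quadForm (G : Matrix (Fin p) (Fin p) ℝ) :
    Continuous (quadForm G : E → ℝ) := by
  unfold quadForm; fun_prop

lemma quadForm_pos {C : Matrix (Fin p) (Fin p) ℝ} (hC : C.PosDef) {u : E} (hu : u ≠ 0) :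
    0 < quadForm C u := by
  have h := hC.dotProduct_mulVec_pos (x := u.ofLp) (by simpa using hu)
  simpa [quadForm, dotProduct, Matrix.mulVec, Finset.mul_sum, mul_assoc] using h

/-- A positive definite quadratic form is coercive. -/
lemma exists_quadForm_ge {C : Matrix (Fin p) (Fin p) ℝ} (hC : C.PosDef) :
    ∃ c > 0, ∀ u : E, c * ‖u‖ ^ 2 ≤ quadForm C u := by
  have key : ∃ c > 0, ∀ u ∈ Metric.sphere (0 : E) 1, c ≤ quadForm C u := by
    rcases (Metric.sphere (0 : E) 1).eq_empty_or_nonempty with h | h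
    · exact ⟨1, one_pos, by simp [h]⟩
    · obtain ⟨x, hx, hmin⟩ := (isCompact_sphere (0 : E) 1).exists_isMinOn h
        (continuous_quadForm C).continuousOn
      refine ⟨quadForm C x, quadForm_pos hC ?_, fun u hu => hmin hu⟩
      rintro rfl
      simp at hx
  obtain ⟨c, hc, h⟩ := key
  refine ⟨c, hc, fun u => ?_⟩
  rcases eq_or_ne u 0 with rfl | hu
  · simp [quadForm_zero]
  · have hn : ‖u‖ ≠ 0 := norm_ne_zero_iff.2 hu
    have h1 := h (‖u‖⁻¹ • u) (by simp [norm_smul, hn])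
    rw [quadForm_smul] at h1
    calc c * ‖u‖ ^ 2 ≤ ‖u‖⁻¹ ^ 2 * quadForm C u * ‖u‖ ^ 2 := by gcongr
      _ = quadForm C u := by field_simp

lemma abs_sign_le_one (x : ℝ) : |Real.sign x| ≤ 1 := by
  rcases Real.sign_apply_eq x with h | h | h <;> simp [h]

lemma limitPenalty_zero (β : E) : limitPenalty β 0 = 0 := by simp [limitPenalty]

lemma scaledPenalty_zero (β : E) (a : ℝ) : scaledPenalty β a 0 = 0 := by simp [scaledPenalty]

lemma abs_limitPenalty_le (β u : E) : |limitPenalty β u| ≤ ∑ j, |u j| := by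
  rw [← Finset.sum_add_sum_compl (activeSet β) fun j => |u j|]
  refine (abs_add_le _ _).trans (add_le_add ?_ ?_)
  · refine (Finset.abs_sum_le_sum_abs _ _).trans (Finset.sum_le_sum fun j _ => ?_)
    rw [abs_mul]
    exact mul_le_of_le_one_right (abs_nonneg _) (abs_sign_le_one _)
  · exact (Finset.abs_sum_le_sum_abs _ _).trans_eq (by simp)

lemma abs_scaledPenalty_sub_le (β : E) {a : ℝ} (ha : 0 < a) (u v : E) :
    |scaledPenalty β a u - scaledPenalty β a v| ≤ ∑ j, |u j - v j| := by
  rw [scaledPenalty, scaledPenalty, ← Finset.sum_sub_distrib]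
  refine (Finset.abs_sum_le_sum_abs _ _).trans (Finset.sum_le_sum fun j _ => ?_)
  rw [← sub_div, abs_div, abs_of_pos ha, div_le_iff₀ ha]
  calc |(|β j + a * u j| - |β j|) - (|β j + a * v j| - |β j|)|
      = |(|β j + a * u j| - |β j + a * v j|)| := by ring_nf
    _ ≤ |(β j + a * u j) - (β j + a * v j)| := abs_abs_sub_abs_le _ _
    _ = |(u j - v j) * a| := by ring_nf
    _ = _ := by rw [abs_mul, abs_of_pos ha]

lemma abs_scaledPenalty_le (β : E) {a : ℝ} (ha : 0 < a) (u : E) :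
    |scaledPenalty β a u| ≤ ∑ j, |u j| := by
  simpa [scaledPenalty_zero] using abs_scaledPenalty_sub_le β ha u 0

/-- For small steps the difference quotient of the `ℓ¹` norm is its directional derivative. -/
lemma scaledPenalty_eq_limitPenalty (β : E) {a : ℝ} (ha : 0 < a) (u : E)
    (h : ∀ j, β j ≠ 0 → a * ‖u‖ < |β j|) : scaledPenalty β a u = limitPenalty β u := by
  rw [scaledPenalty, limitPenalty, ← Finset.sum_add_sum_compl (activeSet β)]
  congr 1
  · refine Finset.sum_congr rfl fun j hj => ?_
    have hj : β j ≠ 0 := by simpa [activeSet] using hj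
    have h1 : |a * u j| < |β j| := by
      rw [abs_mul, abs_of_pos ha]
      exact (mul_le_mul_of_nonneg_left (abs_coord_le_norm u j) ha.le).trans_lt (h j hj)
    rw [div_eq_iff ha.ne']
    rcases hj.lt_or_gt with h2 | h2
    · rw [abs_of_neg h2] at h1 ⊢
      rw [Real.sign_of_neg h2, abs_of_neg (by linarith [abs_lt.1 h1])]
      ring
    · rw [abs_of_pos h2] at h1 ⊢
      rw [Real.sign_of_pos h2, abs_of_pos (by linarith [abs_lt.1 h1])]
      ring
  · refine Finset.sum_congr rfl fun j hj => ?_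
    have hj : β j = 0 := by simpa [activeSet] using hj
    rw [hj, zero_add, abs_zero, sub_zero, abs_mul, abs_of_pos ha]
    field_simp

lemma convexOn_abs_coord_sub (j : Fin p) (b : ℝ) :
    ConvexOn ℝ Set.univ fun u : E => |u j - b| := by
  refine ⟨convex_univ, fun x _ y _ s r hs hr hsr => ?_⟩
  simp only [PiLp.add_apply, PiLp.smul_apply, smul_eq_mul]
  calc |s * x j + r * y j - b| = |s * (x j - b) + r * (y j - b)| := by
        congr 1; linear_combination b * hsr
    _ ≤ |s * (x j - b)| + |r * (y j - b)| := abs_add_le _ _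
    _ = _ := by rw [abs_mul, abs_mul, abs_of_nonneg hs, abs_of_nonneg hr]

lemma ConvexOn.finset_sum_univ {ι F : Type*} [AddCommGroup F] [Module ℝ F] (s : Finset ι)
    {f : ι → F → ℝ} (h : ∀ i, ConvexOn ℝ Set.univ (f i)) :
    ConvexOn ℝ Set.univ fun x => ∑ i ∈ s, f i x := by
  classical
  induction s using Finset.induction_on with
  | empty => simpa using convexOn_const (0 : ℝ) convex_univ
  | insert i s hi ih =>
    simp only [Finset.sum_insert hi]
    exact (h i).add ih

lemma convexOn_coord_mul (j : Fin p) (b : ℝ) :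
    ConvexOn ℝ Set.univ fun u : E => u j * b := by
  refine ⟨convex_univ, fun x _ y _ s r hs hr hsr => le_of_eq ?_⟩
  simp only [PiLp.add_apply, PiLp.smul_apply, smul_eq_mul]
  ring

lemma convexOn_limitPenalty (β : E) : ConvexOn ℝ Set.univ (limitPenalty β) :=
  (ConvexOn.finset_sum_univ _ fun j => convexOn_coord_mul j _).add
    (ConvexOn.finset_sum_univ _ fun j => by simpa using convexOn_abs_coord_sub j 0)

lemma continuous_limitPenalty (β : E) : Continuous (limitPenalty β) := by
  unfold limitPenalty; fun_prop

/-- Quadratic growth of a penalized quadratic around its minimizer. -/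
lemma quadForm_sub_le_of_mem_argminSet {C : Matrix (Fin p) (Fin p) ℝ} {P : E → ℝ}
    (hP : ConvexOn ℝ Set.univ P) {κ θ : ℝ} (hκ : 0 ≤ κ) (hθ : 0 ≤ θ) {w t v : E}
    (hv : v ∈ argminSet (penalizedQuadratic C P κ θ w t)) (y : E) :
    quadForm C (y - v)
      ≤ penalizedQuadratic C P κ θ w t y - penalizedQuadratic C P κ θ w t v := by
  set g : E → ℝ := fun u => (∑ j, u j * (-2 * w j)) + (κ * P u + θ * ∑ j, |u j - t j|) with hg
  have hF : ∀ u, penalizedQuadratic C P κ θ w t u = quadForm C u + g u := fun u => by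
    simp only [penalizedQuadratic, hg, Finset.mul_sum]
    rw [show ∑ j, u j * (-2 * w j) = - ∑ j, 2 * (u j * w j) by
      rw [← Finset.sum_neg_distrib]; exact Finset.sum_congr rfl fun j _ => by ring]
    ring
  have hconv : ConvexOn ℝ Set.univ g :=
    (ConvexOn.finset_sum_univ _ fun j => convexOn_coord_mul j _).add
      ((hP.smul hκ).add ((ConvexOn.finset_sum_univ _ fun j =>
        convexOn_abs_coord_sub j _).smul hθ))
  set d := y - v
  set B := matrixBilin C v d + matrixBilin C d v
  have h1 : ∀ s ∈ Set.Ioo (0 : ℝ) 1, 0 ≤ B + s * quadForm C d + (g y - g v) := by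
    intro s hs
    have h2 := hv (v + s • d)
    rw [hF, hF, quadForm_add_smul] at h2
    have h3 := hconv.2 (Set.mem_univ v) (Set.mem_univ y) (sub_nonneg.2 hs.2.le) hs.1.le
      (sub_add_cancel 1 s)
    rw [show (1 - s) • v + s • y = v + s • d by simp only [d]; module] at h3
    simp only [smul_eq_mul] at h3
    have h4 : 0 ≤ s * (B + s * quadForm C d + (g y - g v)) := by linarith
    exact nonneg_of_mul_nonneg_right h4 hs.1
  have h2 : 0 ≤ B + 0 * quadForm C d + (g y - g v) := by
    have hc : Continuous fun s : ℝ => B + s * quadForm C d + (g y - g v) := by fun_prop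
    refine ge_of_tendsto (hc.tendsto 0 |>.mono_left (nhdsWithin_le_nhds (s := Set.Ioi 0))) ?_
    filter_upwards [Ioo_mem_nhdsGT one_pos] with s hs using h1 s hs
  have h3 : quadForm C y = quadForm C v + B + quadForm C d := by
    have := quadForm_add_smul C v d 1
    rw [one_smul, show v + d = y by simp [d]] at this
    rw [this]; ring
  rw [hF, hF, h3]
  linarith

/-- Points not worse than the origin are bounded. -/
lemma norm_le_of_penalizedQuadratic_le_zero {G : Matrix (Fin p) (Fin p) ℝ} {P : E → ℝ}
    {c κ θ : ℝ} (hκ : 0 ≤ κ) (hθ : 0 ≤ θ) {w t u : E} (hG : c * ‖u‖ ^ 2 ≤ quadForm G u)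
    (hP0 : P 0 = 0) (hP : |P u| ≤ ∑ j, |u j|)
    (hu : penalizedQuadratic G P κ θ w t u ≤ penalizedQuadratic G P κ θ w t 0) :
    c * ‖u‖ ≤ 2 * ‖w‖ + (κ + θ) * p := by
  have h1 : ∑ j, |(0 : E) j - t j| ≤ (∑ j, |u j - t j|) + ∑ j, |u j| := by
    rw [← Finset.sum_add_distrib]
    refine Finset.sum_le_sum fun j _ => ?_
    rw [← abs_neg (u j)]
    refine le_of_eq_of_le ?_ (abs_add_le (u j - t j) (-u j))
    rw [PiLp.zero_apply]
    congr 1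
    ring
  have h2 := abs_sum_mul_le u w
  have h3 := sum_abs_le_mul_norm u
  simp only [penalizedQuadratic, quadForm_zero, hP0] at hu
  simp only [PiLp.zero_apply, zero_mul, Finset.sum_const_zero, mul_zero] at hu h1
  have h4 := mul_le_mul_of_nonneg_left h1 hθ
  have h5 := mul_le_mul_of_nonneg_left (neg_le_of_abs_le hP) hκ
  have h6 := mul_le_mul_of_nonneg_left h3 (add_nonneg hκ hθ)
  have h7 : ‖u‖ * (c * ‖u‖) ≤ ‖u‖ * (2 * ‖w‖ + (κ + θ) * p) := by
    nlinarith [le_of_abs_le h2]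
  rcases (norm_nonneg u).eq_or_lt with h | h
  · rw [← h, mul_zero]; positivity
  · exact le_of_mul_le_mul_left h7 h

lemma continuous_penalizedQuadratic (G : Matrix (Fin p) (Fin p) ℝ) {P : E → ℝ}
    (hP : Continuous P) (κ θ : ℝ) (w t : E) :
    Continuous (penalizedQuadratic G P κ θ w t) := by
  have := continuous_quadForm G
  unfold penalizedQuadratic
  fun_prop

lemma exists_argminSet_eq_singleton {C : Matrix (Fin p) (Fin p) ℝ} (hC : C.PosDef) (β : E)
    {κ θ : ℝ} (hκ : 0 ≤ κ) (hθ : 0 ≤ θ) (w t : E) :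
    ∃ u, argminSet (penalizedQuadratic C (limitPenalty β) κ θ w t) = {u} := by
  obtain ⟨c, hc, hcC⟩ := exists_quadForm_ge hC
  set F := penalizedQuadratic C (limitPenalty β) κ θ w t with hF
  set B := (2 * ‖w‖ + (κ + θ) * p) / c with hB
  have hbound : ∀ u, F u ≤ F 0 → ‖u‖ ≤ B := fun u hu => by
    rw [hB, le_div_iff₀ hc, mul_comm]
    exact norm_le_of_penalizedQuadratic_le_zero hκ hθ (hcC u) (limitPenalty_zero β)
      (abs_limitPenalty_le β u) hu
  have h0 : (0 : E) ∈ Metric.closedBall (0 : E) B := by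
    simpa using hbound 0 le_rfl
  obtain ⟨v, -, hv⟩ := (isCompact_closedBall (0 : E) B).exists_isMinOn ⟨0, h0⟩
    (continuous_penalizedQuadratic C (continuous_limitPenalty β) κ θ w t).continuousOn
  have hmem : v ∈ argminSet F := fun y => by
    rcases le_total (F y) (F 0) with h | h
    · exact hv (by simpa using hbound y h)
    · exact (hv h0).trans h
  refine ⟨v, Set.eq_singleton_iff_unique_mem.2 ⟨hmem, fun y hy => ?_⟩⟩
  have h1 := quadForm_sub_le_of_mem_argminSet (convexOn_limitPenalty β) hκ hθ hmem y
  by_contra hne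
  linarith [quadForm_pos hC (sub_ne_zero.2 hne), hy v]

/-- The minimizer of a limit criterion depends continuously on the linear term and the target. -/
lemma continuous_of_mem_argminSet {C : Matrix (Fin p) (Fin p) ℝ} (hC : C.PosDef) (β : E)
    {κ θ : ℝ} (hκ : 0 ≤ κ) (hθ : 0 ≤ θ) {Φ : E × E → E}
    (hΦ : ∀ x, Φ x ∈ argminSet (penalizedQuadratic C (limitPenalty β) κ θ x.1 x.2)) :
    Continuous Φ := by
  obtain ⟨c, hc, hcC⟩ := exists_quadForm_ge hC
  have key : ∀ x y : E × E, c * ‖Φ y - Φ x‖ ^ 2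
      ≤ 2 * (‖Φ y - Φ x‖ * ‖x.1 - y.1‖) + 2 * θ * ∑ j, |x.2 j - y.2 j| := by
    intro x y
    have h1 := quadForm_sub_le_of_mem_argminSet (convexOn_limitPenalty β) hκ hθ (hΦ x) (Φ y)
    have h2 := hΦ y (Φ x)
    have h3 := (neg_abs_le _).trans' (neg_le_neg (abs_sum_mul_le (Φ y - Φ x) (x.1 - y.1)))
    have h4 : ∀ v : E, abs (∑ j, |v j - x.2 j| - ∑ j, |v j - y.2 j|) ≤ ∑ j, |x.2 j - y.2 j| := by
      intro v
      rw [← Finset.sum_sub_distrib]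
      refine (Finset.abs_sum_le_sum_abs _ _).trans (Finset.sum_le_sum fun j _ => ?_)
      refine (abs_abs_sub_abs_le _ _).trans_eq ?_
      rw [← abs_neg]; ring_nf
    have h5 := mul_le_mul_of_nonneg_left (abs_le.1 (h4 (Φ y))).2 hθ
    have h6 := mul_le_mul_of_nonneg_left (abs_le.1 (h4 (Φ x))).1 hθ
    have h7 : ∑ j, (Φ y - Φ x) j * (x.1 - y.1) j
        = ∑ j, Φ y j * x.1 j - ∑ j, Φ y j * y.1 j - (∑ j, Φ x j * x.1 j
          - ∑ j, Φ x j * y.1 j) := by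
      simp only [← Finset.sum_sub_distrib, PiLp.sub_apply]
      exact Finset.sum_congr rfl fun j _ => by ring
    have h8 := hcC (Φ y - Φ x)
    rw [h7] at h3
    simp only [penalizedQuadratic] at h1 h2
    linarith
  refine continuous_iff_continuousAt.2 fun x => ?_
  have key2 : ∀ y : E × E, ‖Φ y - Φ x‖ ^ 2
      ≤ (2 / c) * ((2 / c) * ‖x.1 - y.1‖ ^ 2 + 2 * θ * ∑ j, |x.2 j - y.2 j|) := by
    intro y
    have h1 := key x y
    have h2 : 2 * (‖Φ y - Φ x‖ * ‖x.1 - y.1‖)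
        ≤ c / 2 * ‖Φ y - Φ x‖ ^ 2 + 2 / c * ‖x.1 - y.1‖ ^ 2 := by
      have : 0 ≤ (c / 2) * (‖Φ y - Φ x‖ - 2 / c * ‖x.1 - y.1‖) ^ 2 := by positivity
      have e : (c / 2) * (‖Φ y - Φ x‖ - 2 / c * ‖x.1 - y.1‖) ^ 2
        = c / 2 * ‖Φ y - Φ x‖ ^ 2 + 2 / c * ‖x.1 - y.1‖ ^ 2
          - 2 * (‖Φ y - Φ x‖ * ‖x.1 - y.1‖) := by field_simp; ring
      linarith
    rw [div_mul_eq_mul_div, le_div_iff₀ hc]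
    linarith
  have hlim : Tendsto (fun y : E × E => (2 / c) * ((2 / c) * ‖x.1 - y.1‖ ^ 2
      + 2 * θ * ∑ j, |x.2 j - y.2 j|)) (𝓝 x) (𝓝 0) := by
    have hcont : Continuous fun y : E × E => (2 / c) * ((2 / c) * ‖x.1 - y.1‖ ^ 2
      + 2 * θ * ∑ j, |x.2 j - y.2 j|) := by fun_prop
    simpa using hcont.tendsto x
  have hsq := squeeze_zero (fun y => sq_nonneg ‖Φ y - Φ x‖) key2 hlim
  rw [ContinuousAt, tendsto_iff_norm_sub_tendsto_zero]
  simpa using hsq.sqrt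

/-- Minimizers of the rescaled problems are uniformly close to the minimizer of the limit
criterion, for bounded linear terms and targets. -/
lemma eventually_norm_sub_le_of_mem_argminSet {C : Matrix (Fin p) (Fin p) ℝ} (hC : C.PosDef)
    (β : E) {G : ℕ → Matrix (Fin p) (Fin p) ℝ} (hG : Tendsto G atTop (𝓝 C)) {a κ θ : ℕ → ℝ}
    (ha : ∀ᶠ n in atTop, 0 < a n) (ha0 : Tendsto a atTop (𝓝 0)) {κ₀ θ₀ : ℝ}
    (hκ₀ : 0 ≤ κ₀) (hθ₀ : 0 ≤ θ₀) (hκ : ∀ᶠ n in atTop, 0 ≤ κ n) (hθ : ∀ᶠ n in atTop, 0 ≤ θ n)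
    (hκlim : Tendsto κ atTop (𝓝 κ₀)) (hθlim : Tendsto θ atTop (𝓝 θ₀)) (R : ℝ) {e : ℝ}
    (he : 0 < e) :
    ∀ᶠ n in atTop, ∀ w t u v : E, ‖w‖ ≤ R → ‖t‖ ≤ R →
      u ∈ argminSet (penalizedQuadratic (G n) (scaledPenalty β (a n)) (κ n) (θ n) w t) →
      v ∈ argminSet (penalizedQuadratic C (limitPenalty β) κ₀ θ₀ w t) → ‖u - v‖ < e := by
  obtain ⟨c, hc, hcC⟩ := exists_quadForm_ge hC
  set B := (2 * R + ((κ₀ + 1) + (θ₀ + 1)) * p) / (c / 2) with hB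
  have hγ : Tendsto (fun n => ∑ i, ∑ j, |(C - G n) i j|) atTop (𝓝 0) := by
    have h1 : Continuous fun M : Matrix (Fin p) (Fin p) ℝ => ∑ i, ∑ j, |(C - M) i j| := by
      fun_prop
    simpa [Function.comp_def] using (h1.tendsto C).comp hG
  set D : ℕ → ℝ := fun n => (∑ i, ∑ j, |(C - G n) i j|) * B ^ 2 + |κ₀ - κ n| * (p * B)
    + |θ₀ - θ n| * (p * (B + R)) with hD
  have hDlim : Tendsto D atTop (𝓝 0) := by
    have h1 : Tendsto (fun n => |κ₀ - κ n|) atTop (𝓝 0) := by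
      simpa using (tendsto_const_nhds (x := κ₀)).sub hκlim |>.abs
    have h2 : Tendsto (fun n => |θ₀ - θ n|) atTop (𝓝 0) := by
      simpa using (tendsto_const_nhds (x := θ₀)).sub hθlim |>.abs
    simpa only [zero_mul, add_zero] using ((hγ.mul_const (B ^ 2)).add (h1.mul_const (p * B))).add
      (h2.mul_const (p * (B + R)))
  have hsmall : ∀ᶠ n in atTop, ∀ j, β j ≠ 0 → a n * B < |β j| := by
    refine eventually_all.2 fun j => ?_
    by_cases hj : β j = 0
    · simp [hj]
    · have h1 : Tendsto (fun n => a n * B) atTop (𝓝 0) := by simpa using ha0.mul_const B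
      filter_upwards [h1.eventually_lt_const (abs_pos.2 hj)] with n hn _ using hn
  filter_upwards [ha, hκ, hθ, hκlim.eventually_lt_const (lt_add_one κ₀),
    hθlim.eventually_lt_const (lt_add_one θ₀), hγ.eventually_lt_const (half_pos hc),
    hDlim.eventually_lt_const (show 0 < c * e ^ 2 / 2 by positivity), hsmall]
    with n han hκn hθn hκ1 hθ1 hγn hDn hsn w t u v hw ht hu hv
  have hp : (0 : ℝ) ≤ p := Nat.cast_nonneg p
  have hR : 0 ≤ R := (norm_nonneg w).trans hw
  have hquad : c / 2 * ‖u‖ ^ 2 ≤ quadForm (G n) u := by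
    have h1 := (le_abs_self _).trans (abs_quadForm_le (C - G n) u)
    rw [quadForm_sub] at h1
    nlinarith [hcC u, sq_nonneg ‖u‖]
  have huB : ‖u‖ ≤ B := by
    rw [hB, le_div_iff₀ (half_pos hc), mul_comm]
    refine (norm_le_of_penalizedQuadratic_le_zero hκn hθn hquad (scaledPenalty_zero β _)
      (abs_scaledPenalty_le β han u) (hu 0)).trans ?_
    gcongr
  have hvB : ‖v‖ ≤ B := by
    rw [hB, le_div_iff₀ (half_pos hc), mul_comm]
    have h1 := norm_le_of_penalizedQuadratic_le_zero hκ₀ hθ₀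
      ((mul_le_mul_of_nonneg_right (half_le_self hc.le) (sq_nonneg _)).trans (hcC v))
      (limitPenalty_zero β) (abs_limitPenalty_le β v) (hv 0)
    refine h1.trans ?_
    gcongr <;> linarith
  have hdiff : ∀ x : E, ‖x‖ ≤ B →
      |penalizedQuadratic C (limitPenalty β) κ₀ θ₀ w t x
        - penalizedQuadratic (G n) (scaledPenalty β (a n)) (κ n) (θ n) w t x| ≤ D n := by
    intro x hx
    have hBn : 0 ≤ B := (norm_nonneg x).trans hx
    rw [penalizedQuadratic, penalizedQuadratic, scaledPenalty_eq_limitPenalty β han x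
      fun j hj => (mul_le_mul_of_nonneg_left hx han.le).trans_lt (hsn j hj)]
    have e1 : quadForm C x - 2 * ∑ j, x j * w j + κ₀ * limitPenalty β x + θ₀ * ∑ j, |x j - t j|
        - (quadForm (G n) x - 2 * ∑ j, x j * w j + κ n * limitPenalty β x
          + θ n * ∑ j, |x j - t j|)
        = quadForm (C - G n) x + (κ₀ - κ n) * limitPenalty β x
          + (θ₀ - θ n) * ∑ j, |x j - t j| := by rw [quadForm_sub]; ring
    rw [e1]
    refine (abs_add_three _ _ _).trans ?_
    rw [abs_mul, abs_mul]
    have h1 : |limitPenalty β x| ≤ p * B :=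
      (abs_limitPenalty_le β x).trans ((sum_abs_le_mul_norm x).trans (by gcongr))
    have h2 : abs (∑ j, |x j - t j|) ≤ p * (B + R) := by
      rw [abs_of_nonneg (Finset.sum_nonneg fun _ _ => abs_nonneg _)]
      refine (sum_abs_le_mul_norm (x - t)).trans ?_
      gcongr
      exact (norm_sub_le _ _).trans (add_le_add hx ht)
    have h3 := abs_quadForm_le (C - G n) x
    simp only [hD]
    gcongr
    exact h3.trans (by gcongr)
  have h1 := quadForm_sub_le_of_mem_argminSet (convexOn_limitPenalty β) hκ₀ hθ₀ hv u
  have h2 := hcC (u - v)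
  have h3 := (abs_le.1 (hdiff u huB)).2
  have h4 := (abs_le.1 (hdiff v hvB)).1
  have h5 := hu v
  have h6 : c * ‖u - v‖ ^ 2 < c * e ^ 2 := by linarith
  exact lt_of_pow_lt_pow_left₀ 2 he.le (lt_of_mul_lt_mul_left h6 hc.le)

/-- If the pull towards `t` dominates, the minimizer is exactly `t`. -/
lemma eq_target_of_mem_argminSet {G : Matrix (Fin p) (Fin p) ℝ} (hG : ∀ d : E, 0 ≤ quadForm G d)
    (β : E) {a κ θ R : ℝ} (ha : 0 < a) (hκ : 0 ≤ κ) {w t u : E} (hw : ‖w‖ ≤ R) (ht : ‖t‖ ≤ R)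
    (hdom : 2 * ((∑ i, ∑ j, |G i j|) + 1) * R < θ - κ)
    (hu : u ∈ argminSet (penalizedQuadratic G (scaledPenalty β a) κ θ w t)) : u = t := by
  set d := u - t with hd
  have hut : u = t + (1 : ℝ) • d := by simp [hd]
  have h1 := hu t
  have h2 := quadForm_add_smul G t d 1
  rw [← hut] at h2
  have h3 := (abs_le.1 (abs_matrixBilin_le G t d)).1
  have h4 := (abs_le.1 (abs_matrixBilin_le G d t)).1
  have h5 := (abs_le.1 (abs_sum_mul_le d w)).2
  have h6 := mul_le_mul_of_nonneg_left (abs_le.1 (abs_scaledPenalty_sub_le β ha u t)).1 hκ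
  have h7 : ∑ j, d j * w j = ∑ j, u j * w j - ∑ j, t j * w j := by
    simp only [hd, ← Finset.sum_sub_distrib, PiLp.sub_apply]
    exact Finset.sum_congr rfl fun j _ => by ring
  have h8 : ∑ j, |u j - t j| = ∑ j, |d j| := by simp [hd]
  have h9 := norm_le_sum_abs d
  have hS : 0 ≤ ∑ i, ∑ j, |G i j| :=
    Finset.sum_nonneg fun _ _ => Finset.sum_nonneg fun _ _ => abs_nonneg _
  rw [h7] at h5
  rw [h8] at h6
  simp only [penalizedQuadratic, sub_self, abs_zero, Finset.sum_const_zero, mul_zero, h8] at h1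
  have hq := hG d
  have hR : 0 ≤ R := (norm_nonneg w).trans hw
  set S := ∑ i, ∑ j, |G i j|
  set L := ∑ j, |d j|
  have b1 : S * (‖t‖ * ‖d‖) ≤ S * (R * L) := by gcongr
  have b2 : ‖d‖ * ‖w‖ ≤ L * R := by gcongr
  have hL : 0 ≤ L := (norm_nonneg d).trans h9
  have h10 : L * ((θ - κ) - 2 * (S + 1) * R) ≤ 0 := by
    rw [mul_comm ‖d‖ ‖t‖] at h4
    nlinarith
  have h11 : L = 0 := by
    by_contra hne
    nlinarith [hL.lt_of_ne' hne]
  have h12 : d = 0 := norm_le_zero_iff.1 (h9.trans_eq h11)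
  exact sub_eq_zero.1 h12

lemma quadForm_gram {n : ℕ} (X : Matrix (Fin n) (Fin p) ℝ) (u : E) :
    quadForm ((1 / (n : ℝ)) • (X.transpose * X)) u
      = (1 / (n : ℝ)) * ∑ i, (∑ j, X i j * u j) ^ 2 := by
  simp only [quadForm, Matrix.smul_apply, Matrix.mul_apply, Matrix.transpose_apply, smul_eq_mul,
    sq, Finset.mul_sum, Finset.sum_mul]
  rw [Finset.sum_comm_cycle]
  refine Finset.sum_congr rfl fun i _ => Finset.sum_congr rfl fun j _ =>
    Finset.sum_congr rfl fun k _ => ?_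
  ring

/-- The rescaled score `s Xᵀ ε`. -/
noncomputable def scaledScore {n : ℕ} (X : Matrix (Fin n) (Fin p) ℝ) (s : ℝ) (ε : Fin n → ℝ) : E :=
  WithLp.toLp 2 fun j => s * ∑ i, X i j * ε i

/-- The Transfer Lasso objective in the local coordinate `u = (b - β) / a`. -/
lemma transferLassoObjective_add_smul {n : ℕ} (hn : 0 < n) (X : Matrix (Fin n) (Fin p) ℝ)
    (β binit : E) (ε : Fin n → ℝ) (lam eta : ℝ) {a : ℝ} (ha : 0 < a) (u : E) :
    transferLassoObjective X (linearResponse X β ε) lam eta binit (β + a • u)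
      = a ^ 2 * penalizedQuadratic ((1 / (n : ℝ)) • (X.transpose * X)) (scaledPenalty β a)
          (lam / (n * a)) (eta / (n * a)) (scaledScore X (1 / (n * a)) ε)
          (a⁻¹ • (binit - β)) u
        + ((1 / (n : ℝ)) * ∑ i, ε i ^ 2 + (lam / n) * ∑ j, |β j|) := by
  have hn' : (n : ℝ) ≠ 0 := by positivity
  have h1 : ∑ i, (linearResponse X β ε i - ∑ j, X i j * (β + a • u) j) ^ 2
      = ∑ i, ε i ^ 2 - 2 * a * (∑ j, u j * ∑ i, X i j * ε i)
        + a ^ 2 * ∑ i, (∑ j, X i j * u j) ^ 2 := by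
    have e : ∑ j, u j * ∑ i, X i j * ε i = ∑ i, ε i * ∑ j, X i j * u j := by
      simp only [Finset.mul_sum]
      rw [Finset.sum_comm]
      exact Finset.sum_congr rfl fun i _ => Finset.sum_congr rfl fun j _ => by ring
    rw [e, Finset.mul_sum, Finset.mul_sum, ← Finset.sum_sub_distrib, ← Finset.sum_add_distrib]
    refine Finset.sum_congr rfl fun i _ => ?_
    have e2 : ∑ j, X i j * (β + a • u) j = ∑ j, X i j * β j + a * ∑ j, X i j * u j := by
      rw [Finset.mul_sum, ← Finset.sum_add_distrib]
      exact Finset.sum_congr rfl fun j _ => by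
        simp only [PiLp.add_apply, PiLp.smul_apply, smul_eq_mul]; ring
    rw [linearResponse, e2]
    ring
  have h2 : ∑ j, |(β + a • u) j| = a * scaledPenalty β a u + ∑ j, |β j| := by
    rw [scaledPenalty, Finset.mul_sum, ← Finset.sum_add_distrib]
    refine Finset.sum_congr rfl fun j _ => ?_
    simp only [PiLp.add_apply, PiLp.smul_apply, smul_eq_mul]
    field_simp
    ring
  have h3 : ∑ j, |(β + a • u) j - binit j| = a * ∑ j, |u j - (a⁻¹ • (binit - β)) j| := by
    rw [Finset.mul_sum]
    refine Finset.sum_congr rfl fun j _ => ?_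
    simp only [PiLp.add_apply, PiLp.smul_apply, PiLp.sub_apply, smul_eq_mul]
    nth_rewrite 2 [← abs_of_pos ha]
    rw [← abs_mul]
    congr 1
    field_simp
    ring
  have h4 : ∑ j, u j * (scaledScore X (1 / (n * a)) ε) j
      = 1 / (n * a) * ∑ j, u j * ∑ i, X i j * ε i := by
    rw [Finset.mul_sum]
    exact Finset.sum_congr rfl fun j _ => by simp only [scaledScore]; ring
  rw [transferLassoObjective, penalizedQuadratic, h1, h2, h3, h4, quadForm_gram]
  field_simp
  ring

lemma smul_sub_mem_argminSet {n : ℕ} (hn : 0 < n) {X : Matrix (Fin n) (Fin p) ℝ}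
    {β binit b : E} {ε : Fin n → ℝ} {lam eta : ℝ} {a : ℝ} (ha : 0 < a)
    (hb : b ∈ argminSet (transferLassoObjective X (linearResponse X β ε) lam eta binit)) :
    a⁻¹ • (b - β) ∈ argminSet (penalizedQuadratic ((1 / (n : ℝ)) • (X.transpose * X))
      (scaledPenalty β a) (lam / (n * a)) (eta / (n * a)) (scaledScore X (1 / (n * a)) ε)
      (a⁻¹ • (binit - β))) := by
  intro y
  have h := hb (β + a • y)
  have e : b = β + a • (a⁻¹ • (b - β)) := by rw [smul_inv_smul₀ ha.ne']; abel
  rw [e, transferLassoObjective_add_smul hn _ _ _ _ _ _ ha,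
    transferLassoObjective_add_smul hn _ _ _ _ _ _ ha] at h
  exact le_of_mul_le_mul_left (le_of_add_le_add_right h) (pow_pos ha 2)

end Deterministic

section Distribution

variable {Ω Ω' Ω'' : Type*} [MeasurableSpace Ω] [MeasurableSpace Ω'] [MeasurableSpace Ω'']
  {μ : Measure Ω} [IsProbabilityMeasure μ] {ν : Measure Ω'} [IsProbabilityMeasure ν]
  {ν' : Measure Ω''} [IsProbabilityMeasure ν']

/-- Convergence in distribution only depends on the law of the limit. -/
lemma tendstoInDistribution_of_map_eq {F : Type*} [TopologicalSpace F] [MeasurableSpace F]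
    [OpensMeasurableSpace F] {Y : ℕ → Ω → F} {Z : Ω' → F} {Z' : Ω'' → F}
    (h : TendstoInDistribution Y atTop Z (fun _ => μ) ν) (hZ' : AEMeasurable Z' ν')
    (hlaw : ν.map Z = ν'.map Z') : TendstoInDistribution Y atTop Z' (fun _ => μ) ν' where
  forall_aemeasurable := h.forall_aemeasurable
  aemeasurable_limit := hZ'
  tendsto := h.tendsto.mono_right (le_of_eq (congrArg 𝓝 (Subtype.ext hlaw)))

/-- Sequences converging in distribution are bounded in probability. -/
lemma exists_eventually_measure_norm_ge_lt {F : Type*} [NormedAddCommGroup F] [MeasurableSpace F]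
    [BorelSpace F] {Y : ℕ → Ω → F} {Z : Ω' → F}
    (h : TendstoInDistribution Y atTop Z (fun _ => μ) ν) {δ : ENNReal} (hδ : 0 < δ) :
    ∃ R : ℝ, ∀ᶠ n in atTop, μ {ω | R ≤ ‖Y n ω‖} < δ := by
  have hclosed : ∀ k : ℕ, IsClosed {x : F | (k : ℝ) ≤ ‖x‖} := fun k =>
    isClosed_le continuous_const continuous_norm
  have := Measure.isProbabilityMeasure_map (μ := ν) h.aemeasurable_limit
  have hlim : Tendsto (fun k : ℕ => ν.map Z {x : F | (k : ℝ) ≤ ‖x‖}) atTop (𝓝 0) := by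
    have h1 := tendsto_measure_iInter_atTop (μ := ν.map Z)
      (s := fun k : ℕ => {x : F | (k : ℝ) ≤ ‖x‖})
      (fun k => (hclosed k).measurableSet.nullMeasurableSet)
      (fun k l hkl x (hx : (l : ℝ) ≤ ‖x‖) => show (k : ℝ) ≤ ‖x‖ from (Nat.cast_le.2 hkl).trans hx) ⟨0, measure_ne_top _ _⟩
    have h2 : ⋂ k : ℕ, {x : F | (k : ℝ) ≤ ‖x‖} = ∅ := by
      refine Set.eq_empty_iff_forall_notMem.2 fun x hx => ?_
      obtain ⟨k, hk⟩ := exists_nat_gt ‖x‖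
      exact absurd (Set.mem_iInter.1 hx k) (not_le.2 hk)
    rwa [h2, measure_empty] at h1
  obtain ⟨k, hk⟩ := (hlim.eventually_lt_const hδ).exists
  refine ⟨k, ?_⟩
  have h1 := (ProbabilityMeasure.limsup_measure_closed_le_of_tendsto h.tendsto
    (hclosed k)).trans_lt hk
  filter_upwards [eventually_lt_of_limsup_lt h1] with n hn
  rwa [ProbabilityMeasure.coe_mk, Measure.map_apply_of_aemeasurable (h.forall_aemeasurable n)
    (hclosed k).measurableSet] at hn

lemma tendstoInMeasure_zero_of_bounded {F F' : Type*} [NormedAddCommGroup F] [MeasurableSpace F]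
    [BorelSpace F] [NormedAddCommGroup F'] {V : ℕ → Ω → F} {V' : Ω' → F} {D : ℕ → Ω → F'}
    (hV : TendstoInDistribution V atTop V' (fun _ => μ) ν)
    (h : ∀ R e : ℝ, 0 < e → ∀ᶠ n in atTop, ∀ᵐ ω ∂μ, ‖V n ω‖ ≤ R → ‖D n ω‖ < e) :
    TendstoInMeasure μ D atTop 0 := by
  rw [tendstoInMeasure_iff_norm]
  intro e he
  refine ENNReal.tendsto_nhds_zero.2 fun δ hδ => ?_
  obtain ⟨R, hR⟩ := exists_eventually_measure_norm_ge_lt hV hδ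
  filter_upwards [hR, h R e he] with n hn1 hn2
  refine (measure_mono_ae ?_).trans hn1.le
  filter_upwards [hn2] with ω hω (h1 : e ≤ _)
  by_contra hlt
  have h2 : ‖V n ω‖ ≤ R := (not_le.1 hlt).le
  have h3 := hω h2
  simp only [Pi.zero_apply, sub_zero] at h1
  linarith

/-- Joint convergence in distribution of independent sequences. -/
lemma tendstoInDistribution_prodMk_of_indepFun {F F' : Type*} [NormedAddCommGroup F]
    [MeasurableSpace F] [BorelSpace F] [SecondCountableTopology F] [NormedAddCommGroup F']
    [MeasurableSpace F'] [BorelSpace F'] [SecondCountableTopology F']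
    {A : ℕ → Ω → F} {A' : Ω' → F} {B : ℕ → Ω → F'} {B' : Ω' → F'}
    (hA : TendstoInDistribution A atTop A' (fun _ => μ) ν)
    (hB : TendstoInDistribution B atTop B' (fun _ => μ) ν)
    (hAB : ∀ n, IndepFun (A n) (B n) μ) (hAB' : IndepFun A' B' ν) :
    TendstoInDistribution (fun n ω => (A n ω, B n ω)) atTop (fun ω => (A' ω, B' ω))
      (fun _ => μ) ν where
  forall_aemeasurable n := (hA.forall_aemeasurable n).prodMk (hB.forall_aemeasurable n)
  aemeasurable_limit := hA.aemeasurable_limit.prodMk hB.aemeasurable_limit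
  tendsto := by
    have h := (ProbabilityMeasure.continuous_prod.tendsto _).comp
      (hA.tendsto.prodMk_nhds hB.tendsto)
    refine Tendsto.congr (fun n => Subtype.ext ?_)
      (h.mono_right (le_of_eq (congrArg 𝓝 (Subtype.ext ?_))))
    · exact ((hAB n).map_prod_eq_prod_map_map (hA.forall_aemeasurable n)
        (hB.forall_aemeasurable n)).symm
    · exact (hAB'.map_prod_eq_prod_map_map hA.aemeasurable_limit hB.aemeasurable_limit).symm

lemma tendstoInMeasure_const_of_tendsto {F : Type*} [NormedAddCommGroup F] {c : ℕ → F} {c₀ : F}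
    (h : Tendsto c atTop (𝓝 c₀)) :
    TendstoInMeasure μ (fun n _ => c n) atTop (fun _ => c₀) :=
  tendstoInMeasure_of_tendsto_ae (fun _ => aestronglyMeasurable_const) (ae_of_all _ fun _ => h)

lemma tendstoInDistribution_prodMk_smul {F : Type*} [NormedAddCommGroup F] [NormedSpace ℝ F]
    [MeasurableSpace F] [BorelSpace F] [SecondCountableTopology F]
    {V : ℕ → Ω → F × F} {V' : Ω' → F × F}
    (hV : TendstoInDistribution V atTop V' (fun _ => μ) ν) {s q : ℕ → ℝ} {s₀ q₀ : ℝ}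
    (hs : Tendsto s atTop (𝓝 s₀)) (hq : Tendsto q atTop (𝓝 q₀)) :
    TendstoInDistribution (fun n ω => (s n • (V n ω).1, q n • (V n ω).2)) atTop
      (fun ω => (s₀ • (V' ω).1, q₀ • (V' ω).2)) (fun _ => μ) ν :=
  hV.continuous_comp_prodMk_of_tendstoInMeasure_const
    (g := fun x : (F × F) × (ℝ × ℝ) => (x.2.1 • x.1.1, x.2.2 • x.1.2)) (by fun_prop)
    (tendstoInMeasure_const_of_tendsto (hs.prodMk_nhds hq)) (fun _ => aemeasurable_const)

end Distribution

section Score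

variable {Ω Ω' : Type*} [MeasurableSpace Ω] [MeasurableSpace Ω']
  {μ : Measure Ω} [IsProbabilityMeasure μ] {ν : Measure Ω'} [IsProbabilityMeasure ν] {p : ℕ}

local notation "E" => EuclideanSpace ℝ (Fin p)

lemma continuous_scaledScore {n : ℕ} (X : Matrix (Fin n) (Fin p) ℝ) (s : ℝ) :
    Continuous (scaledScore X s) := by
  unfold scaledScore; fun_prop

lemma smul_scaledScore {n : ℕ} (X : Matrix (Fin n) (Fin p) ℝ) (r s : ℝ) (ε : Fin n → ℝ) :
    r • scaledScore X s ε = scaledScore X (r * s) ε := by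
  ext j; simp [scaledScore, mul_assoc]

/-- The characteristic function of a rescaled score with independent Gaussian noise. -/
lemma charFun_map_scaledScore {n : ℕ} (X : Matrix (Fin n) (Fin p) ℝ) (s : ℝ) {v : NNReal}
    {ε : Fin n → Ω → ℝ} (hlaw : ∀ i, HasLaw (ε i) (gaussianReal 0 v) μ) (hind : iIndepFun ε μ)
    (t : E) :
    charFun (μ.map fun ω => scaledScore X s fun i => ε i ω) t
      = Complex.exp (-((v * (s ^ 2 * ∑ i, (∑ j, X i j * t j) ^ 2) / 2 : ℝ) : ℂ)) := by
  have hm : ∀ i, AEMeasurable (ε i) μ := fun i => (hlaw i).aemeasurable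
  have hmv : AEMeasurable (fun ω i => ε i ω) μ := aemeasurable_pi_lambda _ hm
  set b : EuclideanSpace ℝ (Fin n) := WithLp.toLp 2 fun i => s * ∑ j, X i j * t j with hb
  have h1 : charFun (μ.map fun ω => scaledScore X s fun i => ε i ω) t
      = charFun (μ.map fun ω => WithLp.toLp 2 (ε · ω)) b := by
    have hms : AEMeasurable (fun ω => scaledScore X s fun i => ε i ω) μ :=
      (continuous_scaledScore X s).measurable.comp_aemeasurable hmv
    rw [charFun_apply, charFun_apply, integral_map hms (by fun_prop),
      integral_map (by fun_prop) (by fun_prop)]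
    congr 1
    ext ω
    congr 3
    simp only [PiLp.inner_apply, scaledScore, hb, RCLike.inner_apply, conj_trivial,
      Finset.mul_sum, Finset.sum_mul]
    rw [Finset.sum_comm]
    exact Finset.sum_congr rfl fun i _ => Finset.sum_congr rfl fun j _ => by ring
  rw [h1, (iIndepFun_iff_charFun_pi hm).1 hind b]
  simp_rw [fun i => (hlaw i).map_eq, charFun_gaussianReal]
  rw [← Complex.exp_sum]
  congr 1
  simp only [hb, Complex.ofReal_zero, mul_zero, zero_mul, zero_sub, Finset.sum_neg_distrib]
  push_cast
  rw [Finset.mul_sum, Finset.mul_sum, Finset.sum_div]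
  congr 1
  exact Finset.sum_congr rfl fun i _ => by ring

/-- Asymptotic normality of the score. -/
lemma tendstoInDistribution_scaledScore {X : (n : ℕ) → Matrix (Fin n) (Fin p) ℝ}
    {C : Matrix (Fin p) (Fin p) ℝ} (hC : C.PosSemidef)
    (hXC : Tendsto (fun n : ℕ => (1 / (n : ℝ)) • ((X n).transpose * X n)) atTop (𝓝 C)) {σ : ℝ}
    {ε : (n : ℕ) → Fin n → Ω → ℝ}
    (hlaw : ∀ n i, HasLaw (ε n i) (gaussianReal 0 (Real.toNNReal (σ ^ 2))) μ)
    (hind : ∀ n, iIndepFun (ε n) μ) {W : Ω' → E}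
    (hW : HasLaw W (multivariateGaussian 0 (σ ^ 2 • C)) ν) :
    TendstoInDistribution
      (fun (n : ℕ) ω => scaledScore (X n) (1 / Real.sqrt n) fun i => ε n i ω) atTop W
      (fun _ => μ) ν where
  forall_aemeasurable n := (continuous_scaledScore _ _).measurable.comp_aemeasurable
    (aemeasurable_pi_lambda _ fun i => (hlaw n i).aemeasurable)
  aemeasurable_limit := hW.aemeasurable
  tendsto := by
    refine ProbabilityMeasure.tendsto_iff_tendsto_charFun.2 fun t => ?_
    simp only [ProbabilityMeasure.coe_mk]
    rw [hW.map_eq, charFun_multivariateGaussian (hC.smul (sq_nonneg σ))]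
    simp_rw [fun n => charFun_map_scaledScore (X n) (1 / Real.sqrt n) (hlaw n) (hind n) t]
    have hcont : Continuous fun M : Matrix (Fin p) (Fin p) ℝ => quadForm M t := by
      unfold quadForm; fun_prop
    have hlim := (((hcont.tendsto C).comp hXC).const_mul (σ ^ 2)).div_const 2
    have e1 : ∀ n : ℕ, (Real.toNNReal (σ ^ 2) : ℝ)
        * ((1 / Real.sqrt n) ^ 2 * ∑ i, (∑ j, X n i j * t j) ^ 2) / 2
        = σ ^ 2 * ((fun M : Matrix (Fin p) (Fin p) ℝ => quadForm M t)
          ∘ fun n : ℕ => (1 / (n : ℝ)) • ((X n).transpose * X n)) n / 2 := fun n => by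
      simp only [Function.comp_apply]
      rw [quadForm_gram, Real.coe_toNNReal _ (sq_nonneg σ), div_pow, one_pow,
        Real.sq_sqrt (Nat.cast_nonneg n)]
    simp_rw [e1]
    have h2 := (Complex.continuous_exp.tendsto _).comp
      ((Complex.continuous_ofReal.tendsto _).comp hlim).neg
    convert h2 using 2
    congr 1
    simp only [inner_zero_right, Complex.ofReal_zero, zero_mul, zero_sub]
    push_cast
    congr 2
    simp only [quadForm, dotProduct, Matrix.mulVec, Finset.mul_sum, Complex.ofReal_sum,
      Complex.ofReal_mul, Matrix.smul_apply, smul_eq_mul, Complex.ofReal_pow]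
    congr 1
    exact Finset.sum_congr rfl fun i _ => Finset.sum_congr rfl fun j _ => by ring

end Score

section TransferLasso

variable {Ω Ω' : Type*} [MeasurableSpace Ω] [MeasurableSpace Ω']
  {μ : Measure Ω} [IsProbabilityMeasure μ] {ν : Measure Ω'} [IsProbabilityMeasure ν] {p : ℕ}

local notation "E" => EuclideanSpace ℝ (Fin p)

/-- Argmin theorem for the rescaled criteria. -/
lemma tendstoInDistribution_argmin {C : Matrix (Fin p) (Fin p) ℝ} (hC : C.PosDef)
    (β : E) {G : ℕ → Matrix (Fin p) (Fin p) ℝ} (hG : Tendsto G atTop (𝓝 C)) {a κ θ : ℕ → ℝ}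
    (ha : ∀ᶠ n in atTop, 0 < a n) (ha0 : Tendsto a atTop (𝓝 0)) {κ₀ θ₀ : ℝ}
    (hκ₀ : 0 ≤ κ₀) (hθ₀ : 0 ≤ θ₀) (hκ : ∀ᶠ n in atTop, 0 ≤ κ n) (hθ : ∀ᶠ n in atTop, 0 ≤ θ n)
    (hκlim : Tendsto κ atTop (𝓝 κ₀)) (hθlim : Tendsto θ atTop (𝓝 θ₀))
    {V : ℕ → Ω → E × E} {V' : Ω' → E × E}
    (hV : TendstoInDistribution V atTop V' (fun _ => μ) ν) {u : ℕ → Ω → E}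
    (hu_meas : ∀ n, AEMeasurable (u n) μ)
    (hu : ∀ᶠ n in atTop, ∀ᵐ ω ∂μ, u n ω ∈ argminSet (penalizedQuadratic (G n)
      (scaledPenalty β (a n)) (κ n) (θ n) (V n ω).1 (V n ω).2)) {Φ : E × E → E}
    (hΦ : ∀ x, Φ x ∈ argminSet (penalizedQuadratic C (limitPenalty β) κ₀ θ₀ x.1 x.2)) :
    TendstoInDistribution u atTop (fun ω => Φ (V' ω)) (fun _ => μ) ν := by
  have hcont := continuous_of_mem_argminSet hC β hκ₀ hθ₀ hΦ
  refine tendstoInDistribution_of_tendstoInMeasure_sub (X := fun n ω => Φ (V n ω)) u _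
    (hV.continuous_comp hcont) ?_ hu_meas
  refine tendstoInMeasure_zero_of_bounded hV fun R e he => ?_
  filter_upwards [hu, eventually_norm_sub_le_of_mem_argminSet hC β hG ha ha0 hκ₀ hθ₀ hκ hθ hκlim
    hθlim R he] with n hn1 hn2
  filter_upwards [hn1] with ω hω hR
  exact hn2 _ _ _ _ ((norm_fst_le _).trans hR) ((norm_snd_le _).trans hR) hω (hΦ _)

/-- The rescaled estimation error minimizes the rescaled criterion. -/
lemma smul_sub_mem_argminSet_rescaled {n m : ℕ} (hn : 0 < n) (hm : 0 < m)
    {X : Matrix (Fin n) (Fin p) ℝ} {β binit b : E} {ε : Fin n → ℝ} {lam eta : ℝ} {a : ℝ}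
    (ha : 0 < a)
    (hb : b ∈ argminSet (transferLassoObjective X (linearResponse X β ε) lam eta binit)) :
    a⁻¹ • (b - β) ∈ argminSet (penalizedQuadratic ((1 / (n : ℝ)) • (X.transpose * X))
      (scaledPenalty β a) (lam / (n * a)) (eta / (n * a))
      ((1 / (Real.sqrt n * a)) • scaledScore X (1 / Real.sqrt n) ε)
      ((1 / (Real.sqrt n * a) * Real.sqrt ((n : ℝ) / m)) • (Real.sqrt m • (binit - β)))) := by
  have hn' : 0 < Real.sqrt n := Real.sqrt_pos.2 (Nat.cast_pos.2 hn)
  have hm' : 0 < Real.sqrt m := Real.sqrt_pos.2 (Nat.cast_pos.2 hm)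
  have e1 : 1 / (Real.sqrt n * a) * (1 / Real.sqrt n) = 1 / ((n : ℝ) * a) := by
    rw [div_mul_div_comm, one_mul, mul_right_comm, Real.mul_self_sqrt (Nat.cast_nonneg n)]
  have e2 : 1 / (Real.sqrt n * a) * Real.sqrt ((n : ℝ) / m) * Real.sqrt m = a⁻¹ := by
    rw [Real.sqrt_div (Nat.cast_nonneg n)]
    field_simp
  rw [smul_scaledScore, smul_smul, e1, e2]
  exact smul_sub_mem_argminSet hn ha hb

/-- Joint limit of the score and of the rescaled initial error. -/
lemma tendstoInDistribution_score_init {X : (n : ℕ) → Matrix (Fin n) (Fin p) ℝ}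
    {C : Matrix (Fin p) (Fin p) ℝ} (hC : C.PosDef) (β : E)
    (hXC : Tendsto (fun n : ℕ => (1 / (n : ℝ)) • ((X n).transpose * X n)) atTop (𝓝 C)) {σ : ℝ}
    {ε : (n : ℕ) → Fin n → Ω → ℝ}
    (hlaw : ∀ n i, HasLaw (ε n i) (gaussianReal 0 (Real.toNNReal (σ ^ 2))) μ)
    (hind : ∀ n, iIndepFun (ε n) μ) {m : ℕ → ℕ} {βinit : ℕ → Ω → E} {Z W : Ω' → E}
    (hinit : TendstoInDistribution
      (fun n ω => Real.sqrt (m n) • (βinit n ω - β)) atTop Z (fun _ => μ) ν)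
    (hsource : ∀ n, IndepFun (βinit n) (fun ω i => ε n i ω) μ)
    (hW : HasLaw W (multivariateGaussian 0 (σ ^ 2 • C)) ν) (hWZ : IndepFun W Z ν) :
    TendstoInDistribution (fun (n : ℕ) ω =>
        (scaledScore (X n) (1 / Real.sqrt n) (fun i => ε n i ω),
          Real.sqrt (m n) • (βinit n ω - β))) atTop
      (fun ω => (W ω, Z ω)) (fun _ => μ) ν := by
  refine tendstoInDistribution_prodMk_of_indepFun
    (tendstoInDistribution_scaledScore hC.posSemidef hXC hlaw hind hW) hinit (fun n => ?_) hWZ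
  exact ((hsource n).comp (φ := fun b : E => Real.sqrt (m n) • (b - β)) (by fun_prop)
    (continuous_scaledScore (X n) (1 / Real.sqrt n)).measurable).symm

end TransferLasso

theorem mainTheorem5
    {Ω Ω' : Type*} [MeasurableSpace Ω] [MeasurableSpace Ω']
    (μ : Measure Ω) [IsProbabilityMeasure μ] (ν : Measure Ω') [IsProbabilityMeasure ν]
    {p : ℕ} (βstar : EuclideanSpace ℝ (Fin p)) (σ : ℝ)
    -- design matrices and their limiting Gram matrix
    (X : (n : ℕ) → Matrix (Fin n) (Fin p) ℝ) (C : Matrix (Fin p) (Fin p) ℝ)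
    (hC : C.PosDef)
    (hXC : Tendsto (fun n : ℕ => (1 / (n : ℝ)) • ((X n).transpose * X n)) atTop (𝓝 C))
    (hXmax : Tendsto (fun n : ℕ => (1 / (n : ℝ)) * ⨆ i : Fin n, ∑ j, X n i j ^ 2) atTop (𝓝 0))
    -- i.i.d. Gaussian noise
    (ε : (n : ℕ) → Fin n → Ω → ℝ)
    (hεlaw : ∀ n i, HasLaw (ε n i) (gaussianReal 0 (Real.toNNReal (σ ^ 2))) μ)
    (hεindep : ∀ n, iIndepFun (ε n) μ)
    -- source sample sizes and the initial estimator
    (m : ℕ → ℕ) (hm : ∀ᶠ n in atTop, 0 < m n) (r0 : ℝ)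
    (hr0 : Tendsto (fun n : ℕ => (n : ℝ) / (m n : ℝ)) atTop (𝓝 r0))
    (βinit : ℕ → Ω → EuclideanSpace ℝ (Fin p)) (Z : Ω' → EuclideanSpace ℝ (Fin p))
    (hinit : TendstoInDistribution
      (fun n ω => Real.sqrt (m n) • (βinit n ω - βstar)) atTop Z (fun _ => μ) ν)
    (hsource : ∀ n, IndepFun (βinit n) (fun ω i => ε n i ω) μ)
    -- regularization parameters and the Transfer Lasso estimator
    (lam eta : ℕ → ℝ) (hlam : ∀ n, 0 ≤ lam n) (heta : ∀ n, 0 ≤ eta n)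
    (βhat : ℕ → Ω → EuclideanSpace ℝ (Fin p)) (hβhat_meas : ∀ n, AEMeasurable (βhat n) μ)
    (hβhat : ∀ n, ∀ᵐ ω ∂μ, βhat n ω ∈ argminSet
      (transferLassoObjective (X n) (linearResponse (X n) βstar (fun i => ε n i ω))
        (lam n) (eta n) (βinit n ω))) :
    -- (i)
    (∀ rho0 : ℝ, 0 ≤ rho0 → rho0 < 1 →
      Tendsto (fun n : ℕ => eta n / Real.sqrt n) atTop atTop →
      Tendsto (fun n : ℕ => lam n / eta n) atTop (𝓝 rho0) →
      TendstoInDistribution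
        (fun n ω => Real.sqrt (m n) • (βhat n ω - βstar)) atTop Z (fun _ => μ) ν) ∧
    -- (ii)
    (∀ lam0 eta0 : ℝ, 0 ≤ lam0 → 0 ≤ eta0 →
      Tendsto (fun n : ℕ => lam n / Real.sqrt n) atTop (𝓝 lam0) →
      Tendsto (fun n : ℕ => eta n / Real.sqrt n) atTop (𝓝 eta0) →
      ∀ W : Ω' → EuclideanSpace ℝ (Fin p),
        HasLaw W (multivariateGaussian 0 (σ ^ 2 • C)) ν → IndepFun W Z ν →
        ∃ U : Ω' → EuclideanSpace ℝ (Fin p),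
          (∀ ω, argminSet (limitCriterionRootN C βstar lam0 eta0 r0 (W ω) (Z ω)) = {U ω}) ∧
          TendstoInDistribution
            (fun (n : ℕ) ω => Real.sqrt n • (βhat n ω - βstar)) atTop U (fun _ => μ) ν) ∧
    -- (iii)
    (∀ rho0' : ℝ, 0 ≤ rho0' →
      Tendsto (fun n : ℕ => lam n / Real.sqrt n) atTop atTop →
      Tendsto (fun n : ℕ => lam n / (n : ℝ)) atTop (𝓝 0) →
      Tendsto (fun n : ℕ => eta n / lam n) atTop (𝓝 rho0') →
      ∃ u₀ : EuclideanSpace ℝ (Fin p),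
        argminSet (limitCriterionSlow C βstar rho0') = {u₀} ∧
        TendstoInDistribution
          (fun (n : ℕ) ω => ((n : ℝ) / lam n) • (βhat n ω - βstar)) atTop
          (fun _ : Ω' => u₀) (fun _ => μ) ν) := by
  have hn0 : ∀ᶠ n : ℕ in atTop, 0 < n := eventually_gt_atTop 0
  have hsqrt : Tendsto (fun n : ℕ => Real.sqrt ((n : ℝ) / m n)) atTop (𝓝 (Real.sqrt r0)) :=
    (Real.continuous_sqrt.tendsto r0).comp hr0
  have hsqrt_top : Tendsto (fun n : ℕ => Real.sqrt n) atTop atTop :=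
    Real.tendsto_sqrt_atTop.comp tendsto_natCast_atTop_atTop
  have ha_inv : Tendsto (fun n : ℕ => (Real.sqrt n)⁻¹) atTop (𝓝 0) :=
    tendsto_inv_atTop_zero.comp hsqrt_top
  have ha_pos : ∀ᶠ n : ℕ in atTop, 0 < (Real.sqrt n)⁻¹ := by
    filter_upwards [hn0] with n hn
    exact inv_pos.2 (Real.sqrt_pos.2 (Nat.cast_pos.2 hn))
  have hscale : ∀ n : ℕ, (n : ℝ) * (Real.sqrt n)⁻¹ = Real.sqrt n := fun n => by
    rw [← div_eq_mul_inv, Real.div_sqrt]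
  have hone : Tendsto (fun n : ℕ => 1 / (Real.sqrt n * (Real.sqrt n)⁻¹)) atTop (𝓝 1) := by
    refine tendsto_const_nhds.congr' ?_
    filter_upwards [hn0] with n hn
    have := Real.sqrt_pos.2 (Nat.cast_pos.2 hn : (0 : ℝ) < n)
    field_simp
  have hargmin : ∀ a : ℕ → ℝ, (∀ᶠ n in atTop, 0 < a n) → ∀ᶠ n : ℕ in atTop, ∀ᵐ ω ∂μ,
      (a n)⁻¹ • (βhat n ω - βstar) ∈ argminSet (penalizedQuadratic
        ((1 / (n : ℝ)) • ((X n).transpose * X n)) (scaledPenalty βstar (a n)) (lam n / (n * a n))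
        (eta n / (n * a n))
        ((1 / (Real.sqrt n * a n)) • scaledScore (X n) (1 / Real.sqrt n) (fun i => ε n i ω))
        ((1 / (Real.sqrt n * a n) * Real.sqrt ((n : ℝ) / m n)) •
          (Real.sqrt (m n) • (βinit n ω - βstar)))) := by
    intro a ha
    filter_upwards [ha, hn0, hm] with n han hn hmn
    filter_upwards [hβhat n] with ω hω using smul_sub_mem_argminSet_rescaled hn hmn han hω
  have herr_meas : ∀ (c : ℕ → ℝ) n, AEMeasurable (fun ω => c n • (βhat n ω - βstar)) μ :=
    fun c n => ((hβhat_meas n).sub aemeasurable_const).const_smul (c n)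
  -- the product space carries an independent pair with the limit laws
  have := Measure.isProbabilityMeasure_map (μ := ν) hinit.aemeasurable_limit
  set π := (multivariateGaussian (0 : EuclideanSpace ℝ (Fin p)) (σ ^ 2 • C)).prod (ν.map Z)
    with hπ
  have hV : TendstoInDistribution (fun (n : ℕ) ω =>
      (scaledScore (X n) (1 / Real.sqrt n) (fun i => ε n i ω),
        Real.sqrt (m n) • (βinit n ω - βstar))) atTop (fun x => (x.1, x.2)) (fun _ => μ) π := by
    refine tendstoInDistribution_score_init hC βstar hXC hεlaw hεindep
      (tendstoInDistribution_of_map_eq hinit measurable_snd.aemeasurable ?_) hsource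
      ⟨measurable_fst.aemeasurable, by simp [hπ, Measure.map_fst_prod]⟩ ?_
    · simp [hπ, Measure.map_snd_prod]
    · exact indepFun_prod measurable_id measurable_id
  refine ⟨fun rho0 _ hrho1 heta_top hratio => ?_,
    fun lam0 eta0 hlam0 heta0 hlamlim hetalim W hW hWZ => ?_,
    fun rho0' hrho0' hlam_top hlam_n hratio => ?_⟩
  · -- the minimizer coincides with the initial estimator with probability tending to one
    have hV1 := tendstoInDistribution_prodMk_smul hV hone (hone.mul hsqrt)
    refine tendstoInDistribution_of_tendstoInMeasure_sub _ _ hinit ?_ (herr_meas _)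
    refine tendstoInMeasure_zero_of_bounded hV1 fun R e he => ?_
    have hdom : Tendsto (fun n : ℕ => eta n / Real.sqrt n - lam n / Real.sqrt n) atTop atTop := by
      have h1 : Tendsto (fun n : ℕ => eta n / Real.sqrt n * (1 - lam n / eta n)) atTop atTop :=
        heta_top.atTop_mul_pos (sub_pos.2 hrho1) (tendsto_const_nhds.sub hratio)
      refine h1.congr' ?_
      filter_upwards [heta_top.eventually_gt_atTop 0] with n hn
      have : eta n ≠ 0 := by
        rintro h
        simp [h] at hn
      field_simp
    have hS : Continuous fun M : Matrix (Fin p) (Fin p) ℝ =>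
        2 * ((∑ i, ∑ j, |M i j|) + 1) * R := by fun_prop
    have hSlim := (hS.tendsto C).comp hXC
    filter_upwards [hargmin _ ha_pos, ha_pos, hSlim.eventually_lt_const (lt_add_one _),
      hdom.eventually_gt_atTop (2 * ((∑ i, ∑ j, |C i j|) + 1) * R + 1), hn0, hm]
      with n hn1 han hn2 hn3 hn hmn
    filter_upwards [hn1] with ω hω hR
    have hG : ∀ d, 0 ≤ quadForm ((1 / (n : ℝ)) • ((X n).transpose * X n)) d := fun d => by
      rw [quadForm_gram]
      positivity
    have h1 := eq_target_of_mem_argminSet hG βstar han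
      (div_nonneg (hlam n) (mul_nonneg (Nat.cast_nonneg n) han.le))
      ((norm_fst_le _).trans hR) ((norm_snd_le _).trans hR)
      (by rw [hscale]; exact hn2.trans hn3) hω
    have hsn := Real.sqrt_pos.2 (Nat.cast_pos.2 hn : (0 : ℝ) < n)
    have hsm := Real.sqrt_pos.2 (Nat.cast_pos.2 hmn : (0 : ℝ) < m n)
    have h2 : βhat n ω - βstar = βinit n ω - βstar := by
      rw [smul_smul, Real.sqrt_div (Nat.cast_nonneg n)] at h1
      rw [show 1 / (Real.sqrt n * (Real.sqrt n)⁻¹) * (Real.sqrt n / Real.sqrt (m n))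
        * Real.sqrt (m n) = (Real.sqrt n)⁻¹⁻¹ by field_simp] at h1
      exact smul_right_injective _ (inv_ne_zero han.ne') h1
    simpa [h2] using he
  · choose Φ hΦ using fun x : EuclideanSpace ℝ (Fin p) × EuclideanSpace ℝ (Fin p) =>
      exists_argminSet_eq_singleton hC βstar hlam0 heta0 x.1 x.2
    refine ⟨fun ω => Φ (W ω, Real.sqrt r0 • Z ω), fun ω => ?_, ?_⟩
    · rw [limitCriterionRootN_eq]
      exact hΦ (W ω, Real.sqrt r0 • Z ω)
    · have hV1 := tendstoInDistribution_prodMk_smul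
        (tendstoInDistribution_score_init hC βstar hXC hεlaw hεindep hinit hsource hW hWZ)
        hone (hone.mul hsqrt)
      have h := tendstoInDistribution_argmin hC βstar hXC ha_pos ha_inv hlam0 heta0
        (κ := fun n : ℕ => lam n / (n * (Real.sqrt n)⁻¹))
        (θ := fun n : ℕ => eta n / (n * (Real.sqrt n)⁻¹))
        (Eventually.of_forall fun n => by have := hlam n; positivity)
        (Eventually.of_forall fun n => by have := heta n; positivity)
        (by simpa only [hscale] using hlamlim) (by simpa only [hscale] using hetalim) hV1
        (herr_meas fun n => (Real.sqrt n)⁻¹⁻¹) (hargmin _ ha_pos)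
        (fun x => (hΦ x).ge (Set.mem_singleton _))
      simpa only [inv_inv, one_mul, one_smul] using h
  · choose Φ hΦ using fun x : EuclideanSpace ℝ (Fin p) × EuclideanSpace ℝ (Fin p) =>
      exists_argminSet_eq_singleton hC βstar zero_le_one hrho0' x.1 x.2
    refine ⟨Φ 0, ?_, ?_⟩
    · rw [limitCriterionSlow_eq]
      exact hΦ 0
    · have hlam_pos : ∀ᶠ n in atTop, 0 < lam n := by
        filter_upwards [hlam_top.eventually_gt_atTop 0] with n hn
        refine (hlam n).lt_of_ne' ?_
        rintro h
        simp [h] at hn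
      have hb_pos : ∀ᶠ n : ℕ in atTop, 0 < lam n / (n : ℝ) := by
        filter_upwards [hlam_pos, hn0] with n h1 h2
        exact div_pos h1 (Nat.cast_pos.2 h2)
      have hmul : ∀ᶠ n : ℕ in atTop, (n : ℝ) * (lam n / n) = lam n := by
        filter_upwards [hn0] with n hn
        have : (n : ℝ) ≠ 0 := by positivity
        field_simp
      have hzero : Tendsto (fun n : ℕ => 1 / (Real.sqrt n * (lam n / n))) atTop (𝓝 0) := by
        refine (tendsto_inv_atTop_zero.comp hlam_top).congr fun n => ?_
        rw [Function.comp_apply, inv_div, mul_div_assoc', one_div_div, ← div_div, Real.div_sqrt]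
      have hV1 := tendstoInDistribution_prodMk_smul hV hzero (hzero.mul hsqrt)
      have h := tendstoInDistribution_argmin hC βstar hXC hb_pos hlam_n zero_le_one hrho0'
        (κ := fun n : ℕ => lam n / (n * (lam n / n)))
        (θ := fun n : ℕ => eta n / (n * (lam n / n)))
        (Eventually.of_forall fun n => by have := hlam n; positivity)
        (Eventually.of_forall fun n => by have := hlam n; have := heta n; positivity)
        (tendsto_const_nhds.congr' (by
          filter_upwards [hmul, hlam_pos] with n h1 h2
          rw [h1, div_self h2.ne']))
        (hratio.congr' (by filter_upwards [hmul] with n h1; rw [h1])) hV1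
        (herr_meas fun n => (lam n / n)⁻¹) (hargmin _ hb_pos)
        (fun x => (hΦ x).ge (Set.mem_singleton _))
      simp only [inv_div, zero_mul, zero_smul] at h
      exact tendstoInDistribution_of_map_eq h aemeasurable_const
        (by simp [Measure.map_const, ← Prod.zero_eq_mk])
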